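/- \textbf{Theorem (Gaussian reduction for unbalanced density control).} Let $T,d,d'\in\mathbb N$, let $A\in\mathbb R^{d\times d}$ be nonsingular, $B\in\mathbb R^{d\times d'}$, $\gamma>0$, and let $\alpha=c_\alpha\mathcal N(m_\alpha,\Sigma_\alpha)$, $\beta=c_\beta\mathcal N(m_\beta,\Sigma_\beta)$ with $c_\alpha,c_\beta>0$ and $\Sigma_\alpha,\Sigma_\beta\succ 0$. For a finite measure $\pi_1$ on $\mathbb R^d$ and kernels $U_t(\mathrm du\mid x)$ from $\mathbb R^d$ to $\mathbb R^{d'}$, $t=1,\dots,T-1$, let $\pi_{t+1}$ be the image of $\pi_t(\mathrm dx)\,U_t(\mathrm du\mid x)$ under $(x,u)\mapsto Ax+Bu$. The pair $(\pi_1,\{U_t\})$ is \emph{feasible} if every $U_t$ is a Markov (probability) kernel, every $\pi_t$, $t=1,\dots,T$, is a finite measure with finite second moment, and $\sum_{t=1}^{T-1}\iint\|u\|^2\,U_t(\mathrm du\mid x)\,\pi_t(\mathrm dx)<\infty$. Its cost is $$J(\pi_1,\{U_t\})=\sum_{t=1}^{T-1}\iint\|u\|^2\,U_t(\mathrm du\mid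 x)\,\pi_t(\mathrm dx)+\gamma\,\mathrm{KL}(\pi_1\,\|\,\alpha)+\gamma\,\mathrm{KL}(\pi_T\,\|\,\beta)\in[0,\infty],$$ where $\mathrm{KL}(\mu\,\|\,\nu)=\int\log\frac{\mathrm d\mu}{\mathrm d\nu}\,\mathrm d\mu-\mu(\mathbb R^d)+\nu(\mathbb R^d)$ if $\mu\ll\nu$, and $+\infty$ otherwise. Let $(\pi_1,\{U_t\})$ be a feasible pair with $c:=\pi_1(\mathbb R^d)>0$. Let $p_t(\mathrm dx,\mathrm du)=c^{-1}U_t(\mathrm du\mid x)\,\pi_t(\mathrm dx)$. Let $m_t,\Sigma_t$ be the mean and covariance of $x$ under $c^{-1}\pi_t$ (the state marginal of $p_t$ when $t\le T-1$), let $\bar u_t,\Sigma^u_t$ be the mean and covariance of $u$ under $p_t$, and let $\Lambda_t=\mathbb E_{p_t}[(u-\bar u_t)(x-m_t)^\top]$. With ${}^\dagger$ the Moore--Penrose inverse, define $$\pi_1^{\rm G}=c\,\mathcal N(m_1,\Sigma_1),\qquad U_t^{\rm G}(\cdot\mid x)=\mathcal N\bigl(\bar u_t+\Lambda_t\Sigma_t^\dagger(x-m_t),\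 \Sigma_t^u-\Lambda_t\Sigma_t^\dagger\Lambda_t^\top\bigr),\quad t=1,\dots,T-1.$$ Then $\Sigma_1$ and all the matrices $\Sigma_t^u-\Lambda_t\Sigma_t^\dagger\Lambda_t^\top$ are positive semidefinite (so these Gaussians are well defined), the pair $(\pi_1^{\rm G},\{U_t^{\rm G}\})$ is feasible, and $$J\bigl(\pi_1^{\rm G},\{U_t^{\rm G}\}\bigr)\le J\bigl(\pi_1,\{U_t\}\bigr).$$ -/

import Mathlib

open MeasureTheory ProbabilityTheory

noncomputable section

namespace UDC

/-! ### The Moore-Penrose inverse of a real square matrix -/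

/-- The four Penrose equations: `Y` is the Moore-Penrose inverse of `X`. -/
structure IsMoorePenrose {d : ℕ} (X Y : Matrix (Fin d) (Fin d) ℝ) : Prop where
  mul_mul_left : X * Y * X = X
  mul_mul_right : Y * X * Y = Y
  symm_left : (X * Y).transpose = X * Y
  symm_right : (Y * X).transpose = Y * X

theorem IsMoorePenrose.unique {d : ℕ} {X Y Z : Matrix (Fin d) (Fin d) ℝ}
    (hY : IsMoorePenrose X Y) (hZ : IsMoorePenrose X Z) : Y = Z := by
  have h1 : X * Y = X * Z := by
    calc X * Y = (X * Y).transpose := hY.symm_left.symm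
      _ = ((X * Z * X) * Y).transpose := by rw [hZ.mul_mul_left]
      _ = ((X * Z) * (X * Y)).transpose := by simp only [Matrix.mul_assoc]
      _ = (X * Y).transpose * (X * Z).transpose := Matrix.transpose_mul _ _
      _ = (X * Y) * (X * Z) := by rw [hY.symm_left, hZ.symm_left]
      _ = (X * Y * X) * Z := by simp only [Matrix.mul_assoc]
      _ = X * Z := by rw [hY.mul_mul_left]
  have h2 : Y * X = Z * X := by
    calc Y * X = (Y * X).transpose := hY.symm_right.symm
      _ = (Y * (X * Z * X)).transpose := by rw [hZ.mul_mul_left]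
      _ = ((Y * X) * (Z * X)).transpose := by simp only [Matrix.mul_assoc]
      _ = (Z * X).transpose * (Y * X).transpose := Matrix.transpose_mul _ _
      _ = (Z * X) * (Y * X) := by rw [hY.symm_right, hZ.symm_right]
      _ = Z * (X * Y * X) := by simp only [Matrix.mul_assoc]
      _ = Z * X := by rw [hY.mul_mul_left]
  calc Y = Y * X * Y := hY.mul_mul_right.symm
    _ = Z * (X * Y) := by rw [h2, Matrix.mul_assoc]
    _ = Z * X * Z := by rw [h1, Matrix.mul_assoc]
    _ = Z := hZ.mul_mul_right

theorem exists_isMoorePenrose {d : ℕ} (X : Matrix (Fin d) (Fin d) ℝ) :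
    ∃ Y, IsMoorePenrose X Y := by
  set H : Matrix (Fin d) (Fin d) ℝ := X.transpose * X with hHdef
  have hHt : H.transpose = H := by simp [hHdef, Matrix.transpose_mul]
  have hH : IsSelfAdjoint H := by
    rw [IsSelfAdjoint, Matrix.star_eq_conjTranspose, Matrix.conjTranspose_eq_transpose_of_trivial,
      hHt]
  -- the spectral pseudo-inverse of `H = Xᵀ X`
  set hS : H.IsHermitian := hH
  set V : Matrix (Fin d) (Fin d) ℝ := (hS.eigenvectorUnitary : Matrix (Fin d) (Fin d) ℝ) with hV
  set D : Matrix (Fin d) (Fin d) ℝ := Matrix.diagonal hS.eigenvalues with hD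
  set E : Matrix (Fin d) (Fin d) ℝ := Matrix.diagonal (fun i => (hS.eigenvalues i)⁻¹) with hE
  have hVV : V.transpose * V = 1 := by
    have := Unitary.coe_star_mul_self hS.eigenvectorUnitary
    simpa [Matrix.star_eq_conjTranspose, Matrix.conjTranspose_eq_transpose_of_trivial, hV]
      using this
  have hspec : H = V * D * V.transpose := by
    have := hS.spectral_theorem
    rw [Unitary.conjStarAlgAut_apply] at this
    simpa [Matrix.star_eq_conjTranspose, Matrix.conjTranspose_eq_transpose_of_trivial, hV, hD,
      Function.comp_def] using this
  have hDED : D * E * D = D := by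
    simp only [hD, hE, Matrix.diagonal_mul_diagonal]
    congr 1; ext i
    exact mul_inv_mul_cancel (hS.eigenvalues i)
  have hEDE : E * D * E = E := by
    simp only [hD, hE, Matrix.diagonal_mul_diagonal]
    congr 1; ext i
    simpa using mul_inv_mul_cancel (hS.eigenvalues i)⁻¹
  have hcancel : ∀ P Q : Matrix (Fin d) (Fin d) ℝ,
      (V * P * V.transpose) * (V * Q * V.transpose) = V * (P * Q) * V.transpose := by
    intro P Q
    calc _ = V * P * (V.transpose * V) * Q * V.transpose := by simp only [Matrix.mul_assoc]
      _ = _ := by rw [hVV, Matrix.mul_one]; simp only [Matrix.mul_assoc]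
  set G : Matrix (Fin d) (Fin d) ℝ := V * E * V.transpose with hG
  have hGt : G.transpose = G := by
    simp [hG, hE, Matrix.transpose_mul, Matrix.mul_assoc]
  have hHGH : H * G * H = H := by rw [hspec, hG, hcancel, hcancel, hDED]
  have hGHG : G * H * G = G := by rw [hspec, hG, hcancel, hcancel, hEDE]
  have hXGH : X * (G * H) = X := by
    have h0 : X.conjTranspose * X * (G * H - 1) = 0 := by
      rw [Matrix.conjTranspose_eq_transpose_of_trivial, ← hHdef, Matrix.mul_sub, ← Matrix.mul_assoc,
        hHGH, Matrix.mul_one, sub_self]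
    have h1 := (Matrix.conjTranspose_mul_self_mul_eq_zero X (G * H - 1)).1 h0
    rwa [Matrix.mul_sub, Matrix.mul_one, sub_eq_zero] at h1
  refine ⟨G * X.transpose, ?_, ?_, ?_, ?_⟩
  · simpa only [hHdef, Matrix.mul_assoc] using hXGH
  · calc G * X.transpose * X * (G * X.transpose) = G * H * G * X.transpose := by
          simp only [hHdef, Matrix.mul_assoc]
      _ = G * X.transpose := by rw [hGHG]
  · simp [Matrix.transpose_mul, hGt, Matrix.mul_assoc]
  · have hGH : (G * H).transpose = G * H := by
      rw [hspec, hG, hcancel]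
      simp [hD, hE, Matrix.transpose_mul, Matrix.mul_assoc]
    simpa only [hHdef, Matrix.mul_assoc] using hGH

/-- The Moore-Penrose inverse `X†`. -/
def pinv {d : ℕ} (X : Matrix (Fin d) (Fin d) ℝ) : Matrix (Fin d) (Fin d) ℝ :=
  Classical.choose (exists_isMoorePenrose X)

theorem isMoorePenrose_pinv {d : ℕ} (X : Matrix (Fin d) (Fin d) ℝ) : IsMoorePenrose X (pinv X) :=
  Classical.choose_spec (exists_isMoorePenrose X)

/-! ### Measures and dynamics -/

/-- The (unbalanced) Gaussian measure `c 𝒩(m, S)`. -/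
def gaussianMeasure {d : ℕ} (c : ℝ) (m : EuclideanSpace ℝ (Fin d)) (S : Matrix (Fin d) (Fin d) ℝ) :
    Measure (EuclideanSpace ℝ (Fin d)) :=
  ENNReal.ofReal c • multivariateGaussian m S

/-- `μ` belongs to `𝓜₂⁺(ℝᵈ)`: a finite measure with finite second moment. -/
def FiniteSecondMoment {d : ℕ} (μ : Measure (EuclideanSpace ℝ (Fin d))) : Prop :=
  IsFiniteMeasure μ ∧ ∫⁻ x, ‖x‖ₑ ^ 2 ∂μ < ⊤

/-- The matrix-vector product `M x` between Euclidean spaces. -/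
def matVec {m n : ℕ} (M : Matrix (Fin m) (Fin n) ℝ) (x : EuclideanSpace ℝ (Fin n)) :
    EuclideanSpace ℝ (Fin m) :=
  WithLp.toLp 2 (M.mulVec (WithLp.ofLp x))

theorem continuous_matVec {m n : ℕ} (M : Matrix (Fin m) (Fin n) ℝ) : Continuous (matVec M) := by
  unfold matVec
  fun_prop

/-- A feedback policy: at each time a kernel `x ↦ U t (· | x)`. With horizon `T` the times are
`0, …, T - 1`, and only the kernels at the times `0, …, T - 2` play a role. -/
abbrev Policy (d d' : ℕ) : Type :=
  ℕ → Kernel (EuclideanSpace ℝ (Fin d)) (EuclideanSpace ℝ (Fin d'))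

/-- The state measures: `π₀` is the initial measure, and `π_{t+1}` is the image of
`π_t(dx) U_t(du | x)` under `(x, u) ↦ A x + B u`. -/
def stateMeasure {d d' : ℕ} (A : Matrix (Fin d) (Fin d) ℝ) (B : Matrix (Fin d) (Fin d') ℝ)
    (π₀ : Measure (EuclideanSpace ℝ (Fin d))) (U : Policy d d') :
    ℕ → Measure (EuclideanSpace ℝ (Fin d))
  | 0 => π₀
  | t + 1 => (stateMeasure A B π₀ U t ⊗ₘ U t).map (fun z => matVec A z.1 + matVec B z.2)

/-- The expected quadratic control effort `∑ₜ ∫ ∫ ‖u‖² U_t(du | x) π_t(dx)` over the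
`T - 1` control times. -/
def controlCost {d d' : ℕ} (T : ℕ) (A : Matrix (Fin d) (Fin d) ℝ) (B : Matrix (Fin d) (Fin d') ℝ)
    (π₀ : Measure (EuclideanSpace ℝ (Fin d))) (U : Policy d d') : ENNReal :=
  ∑ t ∈ Finset.range (T - 1), ∫⁻ x, ∫⁻ u, ‖u‖ₑ ^ 2 ∂(U t x) ∂(stateMeasure A B π₀ U t)

/-- The admissible (feasible) pairs of the unbalanced density control problem with horizon `T`. -/
structure Admissible {d d' : ℕ} (T : ℕ) (A : Matrix (Fin d) (Fin d) ℝ)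
    (B : Matrix (Fin d) (Fin d') ℝ) (π₀ : Measure (EuclideanSpace ℝ (Fin d)))
    (U : Policy d d') : Prop where
  markov : ∀ t < T - 1, IsMarkovKernel (U t)
  moment : ∀ t < T, FiniteSecondMoment (stateMeasure A B π₀ U t)
  control : controlCost T A B π₀ U < ⊤

/-- The objective of the unbalanced density control problem, with values in `[0, ∞]`. Here
`InformationTheory.klDiv μ ν` is `∫ log (dμ/dν) dμ - μ(ℝᵈ) + ν(ℝᵈ)` if `μ ≪ ν`, and `∞` if not. -/
def cost {d d' : ℕ} (T : ℕ) (A : Matrix (Fin d) (Fin d) ℝ) (B : Matrix (Fin d) (Fin d') ℝ)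
    (γ : ℝ) (α β : Measure (EuclideanSpace ℝ (Fin d)))
    (π₀ : Measure (EuclideanSpace ℝ (Fin d))) (U : Policy d d') : ENNReal :=
  controlCost T A B π₀ U + ENNReal.ofReal γ * InformationTheory.klDiv π₀ α
    + ENNReal.ofReal γ * InformationTheory.klDiv (stateMeasure A B π₀ U (T - 1)) β

/-! ### Moments of a pair -/

section Moments

variable {d d' : ℕ} (A : Matrix (Fin d) (Fin d) ℝ) (B : Matrix (Fin d) (Fin d') ℝ)
  (π₀ : Measure (EuclideanSpace ℝ (Fin d))) (U : Policy d d') (t : ℕ)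

/-- The normalized state measure `π_t / c`, with `c` the mass of the initial measure. It is the
state marginal of `jointLaw` at the control times. -/
def stateLaw : Measure (EuclideanSpace ℝ (Fin d)) :=
  (π₀ Set.univ)⁻¹ • stateMeasure A B π₀ U t

/-- The normalized joint law `p_t(dx, du) = c⁻¹ U_t(du | x) π_t(dx)`. -/
def jointLaw : Measure (EuclideanSpace ℝ (Fin d) × EuclideanSpace ℝ (Fin d')) :=
  (π₀ Set.univ)⁻¹ • (stateMeasure A B π₀ U t ⊗ₘ U t)

/-- `m_t = 𝔼[x_t]`. -/
def stateMean : EuclideanSpace ℝ (Fin d) :=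
  ∫ x, x ∂(stateLaw A B π₀ U t)

/-- `Σ_t = Cov(x_t)`. -/
def stateCov : Matrix (Fin d) (Fin d) ℝ :=
  Matrix.of fun i j => cov[fun x => x i, fun x => x j; stateLaw A B π₀ U t]

/-- `ū_t = 𝔼[u_t]`. -/
def controlMean : EuclideanSpace ℝ (Fin d') :=
  ∫ z, z.2 ∂(jointLaw A B π₀ U t)

/-- `Σᵘ_t = Cov(u_t)`. -/
def controlCov : Matrix (Fin d') (Fin d') ℝ :=
  Matrix.of fun i j => cov[fun z => z.2 i, fun z => z.2 j; jointLaw A B π₀ U t]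

/-- `Λ_t = Cov(u_t, x_t)`. -/
def crossCov : Matrix (Fin d') (Fin d) ℝ :=
  Matrix.of fun i j => cov[fun z => z.2 i, fun z => z.1 j; jointLaw A B π₀ U t]

/-- `Σᵘ_t - Λ_t Σ_t† Λ_tᵀ`. -/
def residualCov : Matrix (Fin d') (Fin d') ℝ :=
  controlCov A B π₀ U t
    - crossCov A B π₀ U t * pinv (stateCov A B π₀ U t) * (crossCov A B π₀ U t).transpose

end Moments

/-! ### The Gaussian pair -/

open scoped MatrixOrder in
theorem measurable_affineGaussian {d d' : ℕ} (a : EuclideanSpace ℝ (Fin d'))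
    (K : Matrix (Fin d') (Fin d) ℝ) (m : EuclideanSpace ℝ (Fin d))
    (S : Matrix (Fin d') (Fin d') ℝ) :
    Measurable fun x : EuclideanSpace ℝ (Fin d) =>
      multivariateGaussian (a + matVec K (x - m)) S := by
  refine Measure.measurable_of_measurable_coe _ fun s hs => ?_
  have hf : Measurable fun q : EuclideanSpace ℝ (Fin d) × EuclideanSpace ℝ (Fin d') =>
      a + matVec K (q.1 - m) + Matrix.toEuclideanCLM (𝕜 := ℝ) (CFC.sqrt S) q.2 := by
    have := continuous_matVec K
    fun_prop
  have hmeas := measurable_measure_prodMk_left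
    (ν := stdGaussian (EuclideanSpace ℝ (Fin d'))) (hf hs)
  convert hmeas using 2 with x
  rw [multivariateGaussian, Measure.map_apply (by fun_prop) hs]
  rfl

/-- The kernel `x ↦ 𝒩(a + K (x - m), S)`. -/
def affineGaussianKernel {d d' : ℕ} (a : EuclideanSpace ℝ (Fin d'))
    (K : Matrix (Fin d') (Fin d) ℝ) (m : EuclideanSpace ℝ (Fin d))
    (S : Matrix (Fin d') (Fin d') ℝ) :
    Kernel (EuclideanSpace ℝ (Fin d)) (EuclideanSpace ℝ (Fin d')) where
  toFun x := multivariateGaussian (a + matVec K (x - m)) S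
  measurable' := measurable_affineGaussian a K m S

/-- The Gaussian initial measure with the mass, mean and covariance of the initial measure. -/
def gaussianInit {d d' : ℕ} (A : Matrix (Fin d) (Fin d) ℝ) (B : Matrix (Fin d) (Fin d') ℝ)
    (π₀ : Measure (EuclideanSpace ℝ (Fin d))) (U : Policy d d') :
    Measure (EuclideanSpace ℝ (Fin d)) :=
  gaussianMeasure (π₀.real Set.univ) (stateMean A B π₀ U 0) (stateCov A B π₀ U 0)

/-- The affine-Gaussian policy
`x ↦ 𝒩(ū_t + Λ_t Σ_t† (x - m_t), Σᵘ_t - Λ_t Σ_t† Λ_tᵀ)`. -/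
def gaussianPolicy {d d' : ℕ} (A : Matrix (Fin d) (Fin d) ℝ) (B : Matrix (Fin d) (Fin d') ℝ)
    (π₀ : Measure (EuclideanSpace ℝ (Fin d))) (U : Policy d d') : Policy d d' := fun t =>
  affineGaussianKernel (controlMean A B π₀ U t)
    (crossCov A B π₀ U t * pinv (stateCov A B π₀ U t))
    (stateMean A B π₀ U t) (residualCov A B π₀ U t)

end UDC

end

/-!
Replacing a feasible pair by its matched Gaussian pair does not change the control effort and does
not increase either relative entropy.

*Moments.* Let `(x, u)` have the joint law at time `t`, let `Σ`, `Λ` and `Σᵘ` be the blocks of its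
covariance matrix, and put `K = Λ Σ†`. The part of `x` in the kernel of `Σ` is almost surely
constant, hence `K Σ = Λ` (`covMatrix_mul_pinv_mul`), and `Σᵘ - Λ Σ† Λᵀ` is the covariance of the
regression residual `u - K x` (`posSemidef_covMatrix_sub`). A characteristic function computation
(`map_compProd_affineGaussianKernel`) shows that if `x` is Gaussian and `u` follows the
affine-Gaussian kernel, then every linear combination `C x + D u` is Gaussian; by the identities
for `K` it has the mean and covariance it has under the original joint law
(`map_compProd_regression`). With `C = A`, `D = B` this gives, by induction on `t`, that the
Gaussian trajectory keeps the mass, mean and covariance of the original one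
(`Admissible.stateMeasure_gaussian`); with `C = 0`, `D = 1` it gives equality of the control
efforts, which are second moments (`Admissible.lintegral_control_gaussian`).

*Entropy.* Let `P` have finite relative entropy with respect to a nondegenerate Gaussian `α`, and
let `G` be the Gaussian with the mean and covariance of `P`. As `P` is absolutely continuous, it is
not carried by a hyperplane, so `G` is nondegenerate (`posDef_covMatrix_of_ac`), and both `G` and
`α` have densities whose logarithms are quadratic (`exists_multivariateGaussian_eq_tilted`).
Quadratic functions have the same integrals under `P` and `G`, so
`KL(P ‖ α) - KL(G ‖ α) = KL(P ‖ G) ≥ 0` (`klDiv_tilted_le`). Equal masses make the comparison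
pass to unnormalized measures (`klDiv_smul_le_smul`).
-/

noncomputable section

namespace UDC

open InformationTheory

/-! ### Covariance matrices of random vectors -/

/-- `x ↦ M x` between Euclidean spaces, as a continuous linear map. -/
def matVecL {m n : ℕ} (M : Matrix (Fin m) (Fin n) ℝ) :
    EuclideanSpace ℝ (Fin n) →L[ℝ] EuclideanSpace ℝ (Fin m) :=
  LinearMap.toContinuousLinearMap
    { toFun := matVec M
      map_add' := fun x y => by ext i; simp [matVec, Matrix.mulVec_add]
      map_smul' := fun c x => by ext i; simp [matVec, Matrix.mulVec_smul] }

@[fun_prop]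
theorem measurable_matVec {m n : ℕ} (M : Matrix (Fin m) (Fin n) ℝ) : Measurable (matVec M) :=
  (continuous_matVec M).measurable

theorem matVec_apply {m n : ℕ} (M : Matrix (Fin m) (Fin n) ℝ) (x : EuclideanSpace ℝ (Fin n))
    (i : Fin m) : matVec M x i = ∑ j, M i j * x j := rfl

theorem matVec_mul {l m n : ℕ} (M : Matrix (Fin l) (Fin m) ℝ) (N : Matrix (Fin m) (Fin n) ℝ)
    (x : EuclideanSpace ℝ (Fin n)) : matVec (M * N) x = matVec M (matVec N x) := by
  simp [matVec, Matrix.mulVec_mulVec]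

theorem inner_matVec {m n : ℕ} (M : Matrix (Fin m) (Fin n) ℝ) (x : EuclideanSpace ℝ (Fin n))
    (y : EuclideanSpace ℝ (Fin m)) :
    inner ℝ (matVec M x) y = inner ℝ x (matVec M.transpose y) := by
  simp only [PiLp.inner_apply, matVec_apply, RCLike.inner_apply, conj_trivial, Finset.mul_sum,
    Finset.sum_mul, Matrix.transpose_apply]
  rw [Finset.sum_comm]
  refine Finset.sum_congr rfl fun i _ => Finset.sum_congr rfl fun j _ => by ring

section CovMatrix

variable {Ω : Type*} [MeasurableSpace Ω] {l m n : ℕ}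

/-- The cross-covariance matrix `Cov(X, Y)` of two random vectors, with entries
`Cov(Xᵢ, Yⱼ)`. -/
def covMatrix (P : Measure Ω) (X : Ω → EuclideanSpace ℝ (Fin m))
    (Y : Ω → EuclideanSpace ℝ (Fin n)) : Matrix (Fin m) (Fin n) ℝ :=
  Matrix.of fun i j => cov[fun ω => X ω i, fun ω => Y ω j; P]

variable {P : Measure Ω} {X X' : Ω → EuclideanSpace ℝ (Fin m)}
  {Y Y' : Ω → EuclideanSpace ℝ (Fin n)}

theorem covMatrix_transpose : (covMatrix P X Y).transpose = covMatrix P Y X := by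
  ext i j
  exact covariance_comm _ _

theorem covMatrix_map {Ω' : Type*} [MeasurableSpace Ω'] {Z : Ω' → Ω} {Q : Measure Ω'}
    (hZ : Measurable Z) (hX : Measurable X) (hY : Measurable Y) :
    covMatrix (Q.map Z) X Y = covMatrix Q (fun ω => X (Z ω)) (fun ω => Y (Z ω)) := by
  ext i j
  exact covariance_map_fun (Measurable.aestronglyMeasurable (by fun_prop))
    (Measurable.aestronglyMeasurable (by fun_prop)) hZ.aemeasurable

theorem memLp_matVec (M : Matrix (Fin l) (Fin m) ℝ) (hX : MemLp X 2 P) :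
    MemLp (fun ω => matVec M (X ω)) 2 P :=
  (matVecL M).comp_memLp' hX

variable [IsProbabilityMeasure P]

theorem covMatrix_add_left (hX : MemLp X 2 P) (hX' : MemLp X' 2 P) (hY : MemLp Y 2 P) :
    covMatrix P (fun ω => X ω + X' ω) Y = covMatrix P X Y + covMatrix P X' Y := by
  ext i j
  exact covariance_add_left (hX.eval_piLp i) (hX'.eval_piLp i) (hY.eval_piLp j)

theorem covMatrix_sub_left (hX : MemLp X 2 P) (hX' : MemLp X' 2 P) (hY : MemLp Y 2 P) :
    covMatrix P (fun ω => X ω - X' ω) Y = covMatrix P X Y - covMatrix P X' Y := by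
  ext i j
  exact covariance_sub_left (hX.eval_piLp i) (hX'.eval_piLp i) (hY.eval_piLp j)

theorem covMatrix_add_right (hX : MemLp X 2 P) (hY : MemLp Y 2 P) (hY' : MemLp Y' 2 P) :
    covMatrix P X (fun ω => Y ω + Y' ω) = covMatrix P X Y + covMatrix P X Y' := by
  ext i j
  exact covariance_add_right (hX.eval_piLp i) (hY.eval_piLp j) (hY'.eval_piLp j)

theorem covMatrix_sub_right (hX : MemLp X 2 P) (hY : MemLp Y 2 P) (hY' : MemLp Y' 2 P) :
    covMatrix P X (fun ω => Y ω - Y' ω) = covMatrix P X Y - covMatrix P X Y' := by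
  ext i j
  exact covariance_sub_right (hX.eval_piLp i) (hY.eval_piLp j) (hY'.eval_piLp j)

theorem covMatrix_const_right (a : EuclideanSpace ℝ (Fin n)) :
    covMatrix P X (fun _ => a) = 0 := by
  ext i j
  exact covariance_const_right _

theorem covMatrix_const_left (a : EuclideanSpace ℝ (Fin m)) :
    covMatrix P (fun _ => a) Y = 0 := by
  ext i j
  exact covariance_const_left _

theorem covMatrix_matVec_left (M : Matrix (Fin l) (Fin m) ℝ) (hX : MemLp X 2 P)
    (hY : MemLp Y 2 P) : covMatrix P (fun ω => matVec M (X ω)) Y = M * covMatrix P X Y := by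
  ext i j
  simp only [covMatrix, Matrix.of_apply, matVec_apply, Matrix.mul_apply]
  rw [covariance_fun_sum_left (fun k => (hX.eval_piLp k).const_mul _) (hY.eval_piLp j)]
  simp only [covariance_const_mul_left]

theorem covMatrix_matVec_right (M : Matrix (Fin l) (Fin n) ℝ) (hX : MemLp X 2 P)
    (hY : MemLp Y 2 P) :
    covMatrix P X (fun ω => matVec M (Y ω)) = covMatrix P X Y * M.transpose := by
  rw [← covMatrix_transpose, covMatrix_matVec_left M hY hX, Matrix.transpose_mul,
    covMatrix_transpose]

theorem integral_matVec (M : Matrix (Fin l) (Fin m) ℝ) (hX : MemLp X 2 P) :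
    ∫ ω, matVec M (X ω) ∂P = matVec M (∫ ω, X ω ∂P) :=
  (matVecL M).integral_comp_comm (hX.integrable one_le_two)

theorem posSemidef_covMatrix (hX : MemLp X 2 P) : (covMatrix P X X).PosSemidef := by
  refine Matrix.PosSemidef.of_dotProduct_mulVec_nonneg ?_ fun v => ?_
  · rw [Matrix.IsHermitian, Matrix.conjTranspose_eq_transpose_of_trivial, covMatrix_transpose]
  · -- `vᵀ Cov(X) v` is the variance of `⟨v, X⟩`
    have h := variance_nonneg (fun ω => ∑ i, v i * X ω i) P
    have hm : ∀ i, MemLp (fun ω => v i * X ω i) 2 P := fun i => (hX.eval_piLp i).const_mul _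
    rw [← covariance_self (memLp_finsetSum _ fun i _ => hm i).aestronglyMeasurable.aemeasurable,
      covariance_fun_sum_fun_sum hm hm] at h
    simp only [covariance_const_mul_left, covariance_const_mul_right] at h
    simpa [dotProduct, Matrix.mulVec, covMatrix, Finset.mul_sum, mul_comm, mul_left_comm] using h

/-- The second moment of a random vector in terms of its mean and covariance matrix. -/
theorem integral_norm_sq_eq (hX : MemLp X 2 P) :
    ∫ ω, ‖X ω‖ ^ 2 ∂P = ‖∫ ω, X ω ∂P‖ ^ 2 + (covMatrix P X X).trace := by
  have hi : ∀ i, Integrable (fun ω => X ω i) P := fun i => (hX.eval_piLp i).integrable one_le_two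
  simp only [EuclideanSpace.real_norm_sq_eq, Matrix.trace, Matrix.diag, covMatrix, Matrix.of_apply]
  rw [integral_finsetSum _ fun i _ => (hX.eval_piLp i).integrable_sq, ← Finset.sum_add_distrib]
  refine Finset.sum_congr rfl fun i _ => ?_
  rw [covariance_eq_sub (hX.eval_piLp i) (hX.eval_piLp i), eval_integral_piLp hi]
  simp [pow_two]

/-- A random vector whose covariance matrix vanishes is almost surely constant, hence uncorrelated
with every other one. -/
theorem covMatrix_eq_zero_of_self (hX : MemLp X 2 P) (h : covMatrix P X X = 0) :
    covMatrix P Y X = 0 := by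
  ext i j
  have hv : Var[fun ω => X ω j; P] = 0 := by
    rw [← covariance_self (hX.eval_piLp j).aestronglyMeasurable.aemeasurable]
    exact congrFun (congrFun h j) j
  have hae := ae_eq_integral_of_variance_eq_zero (hX.eval_piLp j) hv
  refine integral_eq_zero_of_ae ?_
  filter_upwards [hae] with ω hω
  simp [hω]

end CovMatrix

/-! ### The regression matrix and the residual covariance -/

theorem IsMoorePenrose.transpose {d : ℕ} {X Y : Matrix (Fin d) (Fin d) ℝ}
    (h : IsMoorePenrose X Y) : IsMoorePenrose X.transpose Y.transpose where
  mul_mul_left := by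
    rw [← Matrix.transpose_mul, ← Matrix.transpose_mul, ← Matrix.mul_assoc, h.mul_mul_left]
  mul_mul_right := by
    rw [← Matrix.transpose_mul, ← Matrix.transpose_mul, ← Matrix.mul_assoc, h.mul_mul_right]
  symm_left := by rw [← Matrix.transpose_mul, h.symm_right, h.symm_right]
  symm_right := by rw [← Matrix.transpose_mul, h.symm_left, h.symm_left]

theorem pinv_transpose_of_symm {d : ℕ} {S : Matrix (Fin d) (Fin d) ℝ} (hS : S.transpose = S) :
    (pinv S).transpose = pinv S := by
  have h := (isMoorePenrose_pinv S).transpose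
  rw [hS] at h
  exact h.unique (isMoorePenrose_pinv S)

section Regression

variable {Ω : Type*} [MeasurableSpace Ω] {m n : ℕ} {P : Measure Ω} [IsProbabilityMeasure P]
  {X : Ω → EuclideanSpace ℝ (Fin m)} {Y : Ω → EuclideanSpace ℝ (Fin n)}

/-- The row space of `Cov(Y, X)` lies in the range of `Cov(X)`: the component of `X` in the
kernel of `Cov(X)` is almost surely constant. Hence `K = Cov(Y, X) Cov(X)†` solves the normal
equations `K Cov(X) = Cov(Y, X)`. -/
theorem covMatrix_mul_pinv_mul (hX : MemLp X 2 P) (hY : MemLp Y 2 P) :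
    covMatrix P Y X * pinv (covMatrix P X X) * covMatrix P X X = covMatrix P Y X := by
  set S := covMatrix P X X with hS
  have hp := isMoorePenrose_pinv S
  -- `Q` is the orthogonal projection onto the kernel of `S`
  set Q : Matrix (Fin m) (Fin m) ℝ := 1 - pinv S * S with hQ
  have hQt : Q.transpose = Q := by rw [hQ, Matrix.transpose_sub, hp.symm_right]; simp
  have hSQ : S * Q = 0 := by
    rw [hQ, Matrix.mul_sub, ← Matrix.mul_assoc, hp.mul_mul_left]; simp
  have hQX := memLp_matVec Q hX
  have h0 : covMatrix P (fun ω => matVec Q (X ω)) (fun ω => matVec Q (X ω)) = 0 := by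
    rw [covMatrix_matVec_left Q hX hQX, covMatrix_matVec_right Q hX hX, hQt, ← hS, hSQ,
      Matrix.mul_zero]
  have h1 := covMatrix_eq_zero_of_self (Y := Y) hQX h0
  rw [covMatrix_matVec_right Q hY hX, hQt, hQ, Matrix.mul_sub, Matrix.mul_one, sub_eq_zero] at h1
  rw [Matrix.mul_assoc, ← h1]

theorem covMatrix_mul_transpose_regression (hX : MemLp X 2 P) (hY : MemLp Y 2 P) :
    covMatrix P X X * (covMatrix P Y X * pinv (covMatrix P X X)).transpose = covMatrix P X Y := by
  have := congrArg Matrix.transpose (covMatrix_mul_pinv_mul hX hY)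
  rwa [Matrix.transpose_mul, covMatrix_transpose, covMatrix_transpose] at this

omit [IsProbabilityMeasure P] in
theorem covMatrix_mul_regression_transpose :
    covMatrix P Y X * (covMatrix P Y X * pinv (covMatrix P X X)).transpose
      = covMatrix P Y X * pinv (covMatrix P X X) * covMatrix P X Y := by
  rw [Matrix.transpose_mul, pinv_transpose_of_symm covMatrix_transpose, covMatrix_transpose,
    Matrix.mul_assoc]

/-- The Schur complement is the covariance matrix of the regression residual `Y - K X`,
`K = Cov(Y, X) Cov(X)†`. -/
theorem posSemidef_covMatrix_sub (hX : MemLp X 2 P) (hY : MemLp Y 2 P) :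
    (covMatrix P Y Y - covMatrix P Y X * pinv (covMatrix P X X)
      * (covMatrix P Y X).transpose).PosSemidef := by
  have hSK := covMatrix_mul_transpose_regression hX hY
  have hYK := covMatrix_mul_regression_transpose (P := P) (X := X) (Y := Y)
  set K := covMatrix P Y X * pinv (covMatrix P X X) with hK
  have hKX := memLp_matVec K hX
  have hR : MemLp (fun ω => Y ω - matVec K (X ω)) 2 P := hY.sub hKX
  convert posSemidef_covMatrix hR using 1
  rw [covMatrix_sub_left hY hKX hR, covMatrix_sub_right hY hY hKX,
    covMatrix_sub_right hKX hY hKX, covMatrix_matVec_left K hX hY, covMatrix_matVec_left K hX hKX,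
    covMatrix_matVec_right K hY hX, covMatrix_matVec_right K hX hX, hSK, hYK, covMatrix_transpose]
  abel

variable {k : ℕ}

theorem integral_matVec_add_matVec (A : Matrix (Fin k) (Fin m) ℝ) (B : Matrix (Fin k) (Fin n) ℝ)
    (hX : MemLp X 2 P) (hY : MemLp Y 2 P) :
    ∫ ω, (matVec A (X ω) + matVec B (Y ω)) ∂P
      = matVec A (∫ ω, X ω ∂P) + matVec B (∫ ω, Y ω ∂P) := by
  rw [integral_add ((memLp_matVec A hX).integrable one_le_two)
    ((memLp_matVec B hY).integrable one_le_two), integral_matVec A hX, integral_matVec B hY]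

/-- The covariance of `A X + B Y`, in the form in which it appears when `Y` is replaced by an
affine function of `X` with gain `K = Cov(Y, X) Cov(X)†` plus an independent noise whose
covariance is the Schur complement. -/
theorem covMatrix_matVec_add_matVec (A : Matrix (Fin k) (Fin m) ℝ) (B : Matrix (Fin k) (Fin n) ℝ)
    (hX : MemLp X 2 P) (hY : MemLp Y 2 P) :
    covMatrix P (fun ω => matVec A (X ω) + matVec B (Y ω))
        (fun ω => matVec A (X ω) + matVec B (Y ω))
      = (A + B * (covMatrix P Y X * pinv (covMatrix P X X))) * covMatrix P X X
          * (A + B * (covMatrix P Y X * pinv (covMatrix P X X))).transpose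
        + B * (covMatrix P Y Y - covMatrix P Y X * pinv (covMatrix P X X)
            * (covMatrix P Y X).transpose) * B.transpose := by
  have hAX := memLp_matVec A hX
  have hBY := memLp_matVec B hY
  have hsum : MemLp (fun ω => matVec A (X ω) + matVec B (Y ω)) 2 P := hAX.add hBY
  have hKS := covMatrix_mul_pinv_mul hX hY
  have hSK := covMatrix_mul_transpose_regression hX hY
  have hYK := covMatrix_mul_regression_transpose (P := P) (X := X) (Y := Y)
  set K := covMatrix P Y X * pinv (covMatrix P X X) with hK
  rw [covMatrix_add_left hAX hBY hsum, covMatrix_add_right hAX hAX hBY,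
    covMatrix_add_right hBY hAX hBY, covMatrix_matVec_left A hX hAX, covMatrix_matVec_left A hX hBY,
    covMatrix_matVec_left B hY hAX, covMatrix_matVec_left B hY hBY, covMatrix_matVec_right A hX hX,
    covMatrix_matVec_right B hX hY, covMatrix_matVec_right A hY hX, covMatrix_matVec_right B hY hY]
  have e1 : (A + B * K) * covMatrix P X X = A * covMatrix P X X + B * covMatrix P Y X := by
    rw [Matrix.add_mul, Matrix.mul_assoc, hKS]
  have e2 : (A + B * K).transpose = A.transpose + K.transpose * B.transpose := by
    rw [Matrix.transpose_add, Matrix.transpose_mul]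
  rw [e1, e2, Matrix.add_mul, Matrix.mul_add, Matrix.mul_add, Matrix.mul_sub, Matrix.sub_mul,
    Matrix.mul_assoc A, Matrix.mul_assoc A, ← Matrix.mul_assoc (covMatrix P X X) K.transpose, hSK,
    Matrix.mul_assoc B (covMatrix P Y X) (K.transpose * B.transpose),
    ← Matrix.mul_assoc (covMatrix P Y X) K.transpose, hYK,
    covMatrix_transpose]
  simp only [Matrix.mul_assoc]
  abel

end Regression

/-! ### Gaussian measures under affine maps and affine-Gaussian kernels -/

instance isMarkovKernel_affineGaussianKernel {d d' : ℕ} (a : EuclideanSpace ℝ (Fin d'))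
    (K : Matrix (Fin d') (Fin d) ℝ) (m : EuclideanSpace ℝ (Fin d))
    (S : Matrix (Fin d') (Fin d') ℝ) : IsMarkovKernel (affineGaussianKernel a K m S) :=
  ⟨fun x => inferInstanceAs (IsProbabilityMeasure (multivariateGaussian (a + matVec K (x - m)) S))⟩

theorem dotProduct_mulVec_transpose {m n : ℕ} (B : Matrix (Fin m) (Fin n) ℝ)
    (R : Matrix (Fin n) (Fin n) ℝ) (t : Fin m → ℝ) :
    (B.transpose.mulVec t) ⬝ᵥ R.mulVec (B.transpose.mulVec t)
      = t ⬝ᵥ (B * R * B.transpose).mulVec t := by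
  rw [← Matrix.mulVec_mulVec, ← Matrix.mulVec_mulVec, Matrix.dotProduct_mulVec t B,
    ← Matrix.mulVec_transpose]

/-- If `x ∼ 𝒩(m, S)` and `u ∼ 𝒩(a + K (x - m), R)` given `x`, then
`A x + B u ∼ 𝒩(A m + B a, (A + B K) S (A + B K)ᵀ + B R Bᵀ)`. -/
theorem map_compProd_affineGaussianKernel {d d' k : ℕ} (A : Matrix (Fin k) (Fin d) ℝ)
    (B : Matrix (Fin k) (Fin d') ℝ) (m : EuclideanSpace ℝ (Fin d)) {S : Matrix (Fin d) (Fin d) ℝ}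
    (hS : S.PosSemidef) (a : EuclideanSpace ℝ (Fin d')) (K : Matrix (Fin d') (Fin d) ℝ)
    {R : Matrix (Fin d') (Fin d') ℝ} (hR : R.PosSemidef) :
    (multivariateGaussian m S ⊗ₘ affineGaussianKernel a K m R).map
        (fun z => matVec A z.1 + matVec B z.2)
      = multivariateGaussian (matVec A m + matVec B a)
          ((A + B * K) * S * (A + B * K).transpose + B * R * B.transpose) := by
  have hpsd : ((A + B * K) * S * (A + B * K).transpose + B * R * B.transpose).PosSemidef := by
    simpa using (hS.mul_mul_conjTranspose_same (A + B * K)).add (hR.mul_mul_conjTranspose_same B)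
  have hmeas : Measurable fun z : EuclideanSpace ℝ (Fin d) × EuclideanSpace ℝ (Fin d') =>
      matVec A z.1 + matVec B z.2 := by fun_prop
  have : IsProbabilityMeasure ((multivariateGaussian m S ⊗ₘ affineGaussianKernel a K m R).map
      (fun z => matVec A z.1 + matVec B z.2)) :=
    Measure.isProbabilityMeasure_map hmeas.aemeasurable
  refine Measure.ext_of_charFun (funext fun t => ?_)
  rw [charFun_multivariateGaussian hpsd, charFun_apply,
    integral_map hmeas.aemeasurable (Measurable.aestronglyMeasurable (by fun_prop)),
    Measure.integral_compProd]
  swap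
  · refine Integrable.of_bound (C := 1) (Measurable.aestronglyMeasurable (by fun_prop)) ?_
    refine Filter.Eventually.of_forall fun z => ?_
    rw [Complex.norm_exp_ofReal_mul_I]
  set s := matVec A.transpose t with hs
  set w := matVec B.transpose t with hw
  set r := matVec (A + B * K).transpose t with hr
  have hrs : r = s + matVec K.transpose w := by
    ext i
    simp [hr, hs, hw, matVec, Matrix.transpose_mul, Matrix.add_mulVec, Matrix.mulVec_mulVec]
  -- the inner integral is the characteristic function of the kernel at `Bᵀ t`
  have hinner : ∀ x : EuclideanSpace ℝ (Fin d),
      ∫ u, Complex.exp ((inner ℝ (matVec A x + matVec B u) t : ℝ) * Complex.I)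
          ∂(affineGaussianKernel a K m R x)
        = Complex.exp ((inner ℝ w a - inner ℝ (matVec K.transpose w) m : ℝ) * Complex.I
            - (w ⬝ᵥ R.mulVec w : ℝ) / 2) * Complex.exp ((inner ℝ x r : ℝ) * Complex.I) := by
    intro x
    have h1 : ∀ u : EuclideanSpace ℝ (Fin d'),
        Complex.exp ((inner ℝ (matVec A x + matVec B u) t : ℝ) * Complex.I)
          = Complex.exp ((inner ℝ x s : ℝ) * Complex.I)
            * Complex.exp ((inner ℝ u w : ℝ) * Complex.I) := by
      intro u
      rw [inner_add_left, inner_matVec, inner_matVec, ← hs, ← hw, ← Complex.exp_add]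
      push_cast; ring_nf
    simp_rw [h1]
    rw [integral_const_mul, ← charFun_apply]
    change _ * charFun (multivariateGaussian (a + matVec K (x - m)) R) w = _
    rw [charFun_multivariateGaussian hR, ← Complex.exp_add, ← Complex.exp_add]
    have h2 : inner ℝ w (a + matVec K (x - m))
        = inner ℝ w a - inner ℝ (matVec K.transpose w) m + inner ℝ x (matVec K.transpose w) := by
      rw [inner_add_right, real_inner_comm (matVec K (x - m)) w, inner_matVec K, inner_sub_left,
        real_inner_comm m]
      ring
    rw [h2, hrs, inner_add_right]
    congr 1
    push_cast
    ring
  simp_rw [hinner]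
  rw [integral_const_mul, ← charFun_apply, charFun_multivariateGaussian hS, ← Complex.exp_add]
  congr 1
  have h3 : inner ℝ t (matVec A m + matVec B a)
      = inner ℝ w a - inner ℝ (matVec K.transpose w) m + inner ℝ r m := by
    rw [hrs, real_inner_comm, inner_add_left, inner_matVec, inner_matVec, ← hs, ← hw,
      inner_add_left, real_inner_comm m s, real_inner_comm a w]
    ring
  have h4 : (t.ofLp ⬝ᵥ ((A + B * K) * S * (A + B * K).transpose + B * R * B.transpose).mulVec t.ofLp)
      = r.ofLp ⬝ᵥ S.mulVec r.ofLp + w.ofLp ⬝ᵥ R.mulVec w.ofLp := by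
    rw [Matrix.add_mulVec, dotProduct_add, ← dotProduct_mulVec_transpose,
      ← dotProduct_mulVec_transpose]
    rfl
  rw [h3, h4]
  push_cast
  ring

theorem memLp_id_multivariateGaussian {d : ℕ} (m : EuclideanSpace ℝ (Fin d))
    (S : Matrix (Fin d) (Fin d) ℝ) : MemLp (fun x => x) 2 (multivariateGaussian m S) :=
  IsGaussian.memLp_two_id

theorem covMatrix_multivariateGaussian {d : ℕ} (m : EuclideanSpace ℝ (Fin d))
    {S : Matrix (Fin d) (Fin d) ℝ} (hS : S.PosSemidef) :
    covMatrix (multivariateGaussian m S) (fun x => x) (fun x => x) = S := by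
  ext i j
  exact covariance_eval_multivariateGaussian hS i j

/-! ### Densities of Gaussian measures -/

theorem integrable_exp_neg_half_norm_sq (d : ℕ) :
    Integrable fun x : EuclideanSpace ℝ (Fin d) => Real.exp (-‖x‖ ^ 2 / 2) := by
  have h := (GaussianFourier.integrable_cexp_neg_mul_sq_norm_add (b := (1 / 2 : ℂ))
    (by norm_num) 0 (0 : EuclideanSpace ℝ (Fin d))).norm
  refine h.congr (Filter.Eventually.of_forall fun x => ?_)
  simp only [Complex.norm_exp, zero_mul, add_zero]
  congr 1
  rw [show -(1 / 2) * (‖x‖ : ℂ) ^ 2 = ((-‖x‖ ^ 2 / 2 : ℝ) : ℂ) by push_cast; ring,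
    Complex.ofReal_re]

/-- The standard Gaussian measure has density proportional to `exp(-‖x‖² / 2)`. -/
theorem stdGaussian_eq_tilted (d : ℕ) :
    stdGaussian (EuclideanSpace ℝ (Fin d)) = volume.tilted fun x => -‖x‖ ^ 2 / 2 := by
  have hint := integrable_exp_neg_half_norm_sq d
  have := isProbabilityMeasure_tilted hint
  refine Measure.ext_of_charFun (funext fun t => ?_)
  rw [charFun_stdGaussian, charFun_apply, integral_tilted]
  set Z := ∫ x : EuclideanSpace ℝ (Fin d), Real.exp (-‖x‖ ^ 2 / 2) with hZ
  have hb : (0 : ℝ) < (1 / 2 : ℂ).re := by norm_num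
  have h1 := GaussianFourier.integral_cexp_neg_mul_sq_norm_add hb Complex.I t
  have h0 := GaussianFourier.integral_cexp_neg_mul_sq_norm hb (V := EuclideanSpace ℝ (Fin d))
  rw [← h0] at h1
  have hZc : (Z : ℂ) = ∫ v : EuclideanSpace ℝ (Fin d), Complex.exp (-(1 / 2) * (‖v‖ : ℂ) ^ 2) := by
    rw [hZ, ← integral_complex_ofReal]
    congr 1; ext v
    push_cast
    congr 1; ring
  have hZ0 : (Z : ℂ) ≠ 0 := by exact_mod_cast (integral_exp_pos hint).ne'
  rw [← hZc] at h1
  have h2 : ∀ x : EuclideanSpace ℝ (Fin d),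
      (Real.exp (-‖x‖ ^ 2 / 2) / Z) • Complex.exp ((inner ℝ x t : ℝ) * Complex.I)
        = (Z : ℂ)⁻¹ * Complex.exp (-(1 / 2) * (‖x‖ : ℂ) ^ 2 + Complex.I * (inner ℝ t x : ℝ)) := by
    intro x
    rw [Complex.exp_add, Complex.real_smul, real_inner_comm]
    push_cast
    rw [show -(1 / 2) * (‖x‖ : ℂ) ^ 2 = -(‖x‖ : ℂ) ^ 2 / 2 by ring, mul_comm Complex.I]
    ring
  simp_rw [h2]
  rw [integral_const_mul, h1, ← mul_assoc, inv_mul_cancel₀ hZ0, one_mul, Complex.I_sq]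
  congr 1
  ring

/-- Transport of a measure with density `exp f / Z` by an equivalence `e` that maps the reference
measure to a multiple of another one: the constant is absorbed in the normalization. -/
theorem map_tilted_of_map_eq_smul {α β : Type*} [MeasurableSpace α] [MeasurableSpace β]
    {μ : Measure α} {ν : Measure β} (e : α ≃ᵐ β) {c : ENNReal} (hc : c ≠ 0) (hc' : c ≠ ⊤)
    (he : μ.map e = c • ν) (f : α → ℝ) :
    (μ.tilted f).map e = ν.tilted (fun y => f (e.symm y)) := by
  have hZ : ∫ x, Real.exp (f x) ∂μ = c.toReal * ∫ y, Real.exp (f (e.symm y)) ∂ν := by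
    rw [← smul_eq_mul, ← integral_smul_measure, ← he, integral_map_equiv]
    simp
  ext s hs
  rw [e.map_apply, tilted_apply' _ _ (e.measurable hs), tilted_apply' _ _ hs]
  have h1 : ∫⁻ a in e ⁻¹' s, ENNReal.ofReal (Real.exp (f a) / ∫ x, Real.exp (f x) ∂μ) ∂μ
      = ∫⁻ y in s, ENNReal.ofReal (Real.exp (f (e.symm y)) / ∫ x, Real.exp (f x) ∂μ) ∂(c • ν) := by
    rw [← he, e.restrict_map, lintegral_map_equiv]
    simp
  rw [h1, Measure.restrict_smul, lintegral_smul_measure, smul_eq_mul, hZ,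
    ← lintegral_const_mul' _ _ hc']
  refine lintegral_congr fun y => ?_
  rw [← ENNReal.ofReal_toReal hc', ← ENNReal.ofReal_mul ENNReal.toReal_nonneg,
    ENNReal.toReal_ofReal ENNReal.toReal_nonneg]
  congr 1
  have : c.toReal ≠ 0 := ENNReal.toReal_ne_zero.2 ⟨hc, hc'⟩
  field_simp

open scoped MatrixOrder in
/-- A nondegenerate Gaussian measure has a density whose logarithm is, up to a constant,
`-‖L (x - m)‖² / 2` for some matrix `L`. -/
theorem exists_multivariateGaussian_eq_tilted {d : ℕ} (m : EuclideanSpace ℝ (Fin d))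
    {S : Matrix (Fin d) (Fin d) ℝ} (hS : S.PosDef) :
    ∃ L : Matrix (Fin d) (Fin d) ℝ, multivariateGaussian m S
      = volume.tilted fun x => -‖matVec L (x - m)‖ ^ 2 / 2 := by
  set Q := CFC.sqrt S with hQ
  have hQQ : Q * Q = S := CFC.sqrt_mul_sqrt_self _ hS.posSemidef.nonneg
  have hdet : Q.det ≠ 0 := by
    intro h0
    have := hS.det_pos
    rw [← hQQ, Matrix.det_mul, h0] at this
    simp at this
  have hu : IsUnit Q.det := hdet.isUnit
  have hinv : ∀ x, matVec Q⁻¹ (matVec Q x) = x := fun x => by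
    rw [← matVec_mul, Matrix.nonsing_inv_mul _ hu]; simp [matVec]
  have hinv' : ∀ x, matVec Q (matVec Q⁻¹ x) = x := fun x => by
    rw [← matVec_mul, Matrix.mul_nonsing_inv _ hu]; simp [matVec]
  let e : EuclideanSpace ℝ (Fin d) ≃ᵐ EuclideanSpace ℝ (Fin d) :=
    { toFun := fun x => m + matVec Q x
      invFun := fun y => matVec Q⁻¹ (y - m)
      left_inv := fun x => by simp [hinv]
      right_inv := fun y => by simp [hinv']
      measurable_toFun := by
        change Measurable fun x => m + matVec Q x
        fun_prop
      measurable_invFun := by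
        change Measurable fun y => matVec Q⁻¹ (y - m)
        fun_prop }
  have hld : LinearMap.det (matVecL Q : EuclideanSpace ℝ (Fin d) →ₗ[ℝ] _) ≠ 0 := by
    have hmul : (matVecL Q : EuclideanSpace ℝ (Fin d) →ₗ[ℝ] EuclideanSpace ℝ (Fin d))
        * (matVecL Q⁻¹ : EuclideanSpace ℝ (Fin d) →ₗ[ℝ] EuclideanSpace ℝ (Fin d)) = 1 :=
      LinearMap.ext hinv'
    intro h0
    have := congrArg LinearMap.det hmul
    rw [map_mul, h0, zero_mul, map_one] at this
    exact zero_ne_one this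
  -- an invertible affine map multiplies the Lebesgue measure by a constant
  obtain ⟨c, hc, hc', he⟩ : ∃ c : ENNReal, c ≠ 0 ∧ c ≠ ⊤ ∧
      (volume : Measure (EuclideanSpace ℝ (Fin d))).map e = c • volume := by
    refine ⟨ENNReal.ofReal |(LinearMap.det
      (matVecL Q : EuclideanSpace ℝ (Fin d) →ₗ[ℝ] EuclideanSpace ℝ (Fin d)))⁻¹|, ?_,
      ENNReal.ofReal_ne_top, ?_⟩
    rotate_left
    · have h1 := Measure.map_linearMap_addHaar_eq_smul_addHaar
        (volume : Measure (EuclideanSpace ℝ (Fin d))) hld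
      have h2 : (e : EuclideanSpace ℝ (Fin d) → _) = (fun y => m + y) ∘ matVec Q := rfl
      rw [h2, ← Measure.map_map (measurable_const_add m) (measurable_matVec Q)]
      change Measure.map _ (Measure.map
        (matVecL Q : EuclideanSpace ℝ (Fin d) →ₗ[ℝ] EuclideanSpace ℝ (Fin d)) _) = _
      rw [h1, Measure.map_smul, map_add_left_eq_self]
    · rw [Ne, ENNReal.ofReal_eq_zero, not_le]
      positivity
  refine ⟨Q⁻¹, ?_⟩
  rw [multivariateGaussian, stdGaussian_eq_tilted]
  exact map_tilted_of_map_eq_smul e hc hc' he _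

/-! ### Gaussian laws minimize the relative entropy to a Gaussian at given moments -/

/-- If `g` and `f` have the same integrals under `P` and `ν.tilted g`, then
`KL(P ‖ ν.tilted f) - KL(ν.tilted g ‖ ν.tilted f) = KL(P ‖ ν.tilted g) ≥ 0`. -/
theorem klDiv_tilted_le {E : Type*} [MeasurableSpace E] {ν : Measure E} [SigmaFinite ν]
    {P : Measure E} [IsProbabilityMeasure P] {f g : E → ℝ}
    (hf : Integrable (fun x => Real.exp (f x)) ν) (hg : Integrable (fun x => Real.exp (g x)) ν)
    (hfP : Integrable f P) (hgP : Integrable g P) (hfG : Integrable f (ν.tilted g))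
    (hgG : Integrable g (ν.tilted g)) (hfe : ∫ x, f x ∂(ν.tilted g) = ∫ x, f x ∂P)
    (hge : ∫ x, g x ∂(ν.tilted g) = ∫ x, g x ∂P) (hP : P ≪ ν.tilted f)
    (hint : Integrable (llr P (ν.tilted f)) P) :
    ν.tilted g ≪ ν.tilted f ∧ Integrable (llr (ν.tilted g) (ν.tilted f)) (ν.tilted g) ∧
      klDiv (ν.tilted g) (ν.tilted f) ≤ klDiv P (ν.tilted f) := by
  have hPν : P ≪ ν := hP.trans (tilted_absolutelyContinuous ν f)
  have : NeZero ν := ⟨fun h => IsProbabilityMeasure.ne_zero P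
    (Measure.absolutelyContinuous_zero_iff.1 (h ▸ hPν))⟩
  have hpf := isProbabilityMeasure_tilted hf
  have hpg := isProbabilityMeasure_tilted hg
  have hGν : ν.tilted g ≪ ν := tilted_absolutelyContinuous ν g
  have hGα : ν.tilted g ≪ ν.tilted f := hGν.trans (absolutelyContinuous_tilted hf)
  have hPG : P ≪ ν.tilted g := hPν.trans (absolutelyContinuous_tilted hg)
  have hPint : Integrable (llr P ν) P := by
    have h1 := (integrable_congr (llr_tilted_right hPν hf)).1 hint
    have h2 := h1.sub (hfP.neg.add (integrable_const (Real.log (∫ z, Real.exp (f z) ∂ν))))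
    refine h2.congr (Filter.Eventually.of_forall fun x => ?_)
    simp
  have hllrG : llr (ν.tilted g) ν =ᵐ[ν.tilted g]
      fun x => g x - Real.log (∫ z, Real.exp (g z) ∂ν) :=
    hGν.ae_le (log_rnDeriv_tilted_left_self hg)
  have hGint : Integrable (llr (ν.tilted g) ν) (ν.tilted g) :=
    (integrable_congr hllrG).2 (hgG.sub (integrable_const _))
  have hGαint := integrable_llr_tilted_right hGν hfG hGint hf
  refine ⟨hGα, hGαint, ?_⟩
  have hPGint := integrable_llr_tilted_right hPν hgP hPint hg
  have h0 := integral_llr_add_sub_measure_univ_nonneg hPG hPGint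
  rw [integral_llr_tilted_right hPν hgP hg hPint] at h0
  rw [klDiv_of_ac_of_integrable hGα hGαint, klDiv_of_ac_of_integrable hP hint,
    integral_llr_tilted_right hPν hfP hf hPint, integral_llr_tilted_right hGν hfG hf hGint,
    integral_congr_ae hllrG, integral_sub hgG (integrable_const _), hfe, hge]
  refine ENNReal.ofReal_le_ofReal ?_
  simp only [probReal_univ, integral_const, smul_eq_mul, one_mul] at h0 ⊢
  linarith

theorem ac_and_integrable_llr_of_smul {E : Type*} [MeasurableSpace E] {P α : Measure E}
    [IsFiniteMeasure P] [IsFiniteMeasure α] {k : NNReal} (hk : k ≠ 0) :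
    (k • P ≪ α ∧ Integrable (llr (k • P) α) (k • P)) ↔ (P ≪ α ∧ Integrable (llr P α) P) := by
  have hac : k • P ≪ α ↔ P ≪ α :=
    ⟨fun h => (Measure.absolutelyContinuous_smul (c := (k : ENNReal)) (by simpa)).trans h, fun h => h.smul_left k⟩
  rw [hac]
  refine and_congr_right fun h => ?_
  rw [← Measure.coe_nnreal_smul, integrable_smul_measure (by simpa) (by simp),
    Measure.coe_nnreal_smul, integrable_congr (llr_smul_nnreal_left h k hk),
    integrable_add_const_iff]

/-- A comparison of relative entropies of probability measures persists after scaling, because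
`KL(k P ‖ α)` is an increasing affine function of `KL(P ‖ α)` that depends only on `k` and the
masses. -/
theorem klDiv_smul_le_smul {E : Type*} [MeasurableSpace E] {P G α : Measure E}
    [IsProbabilityMeasure P] [IsProbabilityMeasure G] [IsFiniteMeasure α] {c a : NNReal}
    (hc : c ≠ 0) (ha : a ≠ 0)
    (h : P ≪ α → Integrable (llr P α) P →
      G ≪ α ∧ Integrable (llr G α) G ∧ klDiv G α ≤ klDiv P α) :
    klDiv (c • G) (a • α) ≤ klDiv (c • P) (a • α) := by
  rw [klDiv_smul_right_eq_smul_left ha, klDiv_smul_right_eq_smul_left ha, smul_smul, smul_smul]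
  have hk : a⁻¹ * c ≠ 0 := mul_ne_zero (inv_ne_zero ha) hc
  set k := a⁻¹ * c
  refine mul_le_mul_right ?_ _
  by_cases htop : klDiv (k • P) α = ⊤
  · rw [htop]; exact le_top
  obtain ⟨hP, hPi⟩ := (ac_and_integrable_llr_of_smul hk).1 (klDiv_ne_top_iff.1 htop)
  obtain ⟨hG, hGi, hle⟩ := h hP hPi
  have htop' : klDiv (k • G) α ≠ ⊤ :=
    klDiv_ne_top_iff.2 ((ac_and_integrable_llr_of_smul hk).2 ⟨hG, hGi⟩)
  rw [← ENNReal.toReal_le_toReal htop' htop, toReal_klDiv_smul_left hG hGi,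
    toReal_klDiv_smul_left hP hPi]
  have := ENNReal.toReal_mono (klDiv_ne_top hP hPi) hle
  simp only [probReal_univ]
  gcongr

section Moments

variable {d : ℕ} {P : Measure (EuclideanSpace ℝ (Fin d))} [IsProbabilityMeasure P]

theorem memLp_matVec_sub (hP : MemLp (fun x => x) 2 P) (L : Matrix (Fin d) (Fin d) ℝ)
    (a : EuclideanSpace ℝ (Fin d)) : MemLp (fun x => matVec L (x - a)) 2 P :=
  memLp_matVec L (hP.sub (memLp_const a))

theorem integrable_neg_half_norm_sq (hP : MemLp (fun x => x) 2 P) (L : Matrix (Fin d) (Fin d) ℝ)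
    (a : EuclideanSpace ℝ (Fin d)) : Integrable (fun x => -‖matVec L (x - a)‖ ^ 2 / 2) P :=
  ((memLp_matVec_sub hP L a).integrable_norm_pow two_ne_zero).neg.div_const 2

/-- The integral of a quadratic function depends on the mean and covariance only. -/
theorem integral_neg_half_norm_sq (hP : MemLp (fun x => x) 2 P) (L : Matrix (Fin d) (Fin d) ℝ)
    (a : EuclideanSpace ℝ (Fin d)) :
    ∫ x, -‖matVec L (x - a)‖ ^ 2 / 2 ∂P
      = -(‖matVec L ((∫ x, x ∂P) - a)‖ ^ 2
          + (L * covMatrix P (fun x => x) (fun x => x) * L.transpose).trace) / 2 := by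
  have ha : MemLp (fun _ : EuclideanSpace ℝ (Fin d) => a) 2 P := memLp_const a
  have hs : MemLp (fun x => x - a) 2 P := hP.sub ha
  rw [integral_div, integral_neg, integral_norm_sq_eq (memLp_matVec_sub hP L a),
    integral_matVec L hs, covMatrix_matVec_left L hs (memLp_matVec_sub hP L a),
    covMatrix_matVec_right L hs hs, covMatrix_sub_left hP ha hs, covMatrix_sub_right hP hP ha,
    covMatrix_const_left, covMatrix_const_right,
    integral_sub (hP.integrable one_le_two) (ha.integrable one_le_two)]
  simp [Matrix.mul_assoc]

/-- A law with a density has a nondegenerate covariance matrix, since otherwise it would be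
carried by a hyperplane. -/
theorem posDef_covMatrix_of_ac (hP : MemLp (fun x => x) 2 P) (hac : P ≪ volume) :
    (covMatrix P (fun x => x) (fun x => x)).PosDef := by
  have hpsd := posSemidef_covMatrix hP
  refine Matrix.PosDef.of_dotProduct_mulVec_pos hpsd.isHermitian fun v hv => ?_
  refine lt_of_le_of_ne (hpsd.dotProduct_mulVec_nonneg v) fun h0 => ?_
  have hm : ∀ i, MemLp (fun x : EuclideanSpace ℝ (Fin d) => v i * x i) 2 P :=
    fun i => (hP.eval_piLp i).const_mul _
  have hvar : Var[fun x : EuclideanSpace ℝ (Fin d) => ∑ i, v i * x i; P] = 0 := by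
    rw [← covariance_self (memLp_finsetSum _ fun i _ => hm i).aestronglyMeasurable.aemeasurable,
      covariance_fun_sum_fun_sum hm hm]
    simp only [covariance_const_mul_left, covariance_const_mul_right]
    rw [h0]
    simp [dotProduct, Matrix.mulVec, covMatrix, Finset.mul_sum, mul_comm, mul_left_comm]
  have hae := ae_eq_integral_of_variance_eq_zero (memLp_finsetSum _ fun i _ => hm i) hvar
  set b := ∫ x : EuclideanSpace ℝ (Fin d), ∑ i, v i * x i ∂P with hb
  -- the hyperplane `{x | ⟨v, x⟩ = b}` is Lebesgue-null
  let ℓ : EuclideanSpace ℝ (Fin d) →ₗ[ℝ] ℝ :=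
    { toFun := fun x => ∑ i, v i * x i
      map_add' := fun x y => by simp [mul_add, Finset.sum_add_distrib]
      map_smul' := fun r x => by simp [Finset.mul_sum, mul_left_comm] }
  have hℓv : ℓ (WithLp.toLp 2 v) ≠ 0 := by
    change v ⬝ᵥ v ≠ 0
    simpa [dotProduct_self_eq_zero] using hv
  have hnull : (volume : Measure (EuclideanSpace ℝ (Fin d))) {x | ℓ x = b} = 0 := by
    let x₀ : EuclideanSpace ℝ (Fin d) := (b / ℓ (WithLp.toLp 2 v)) • WithLp.toLp 2 v
    have hx₀ : ℓ x₀ = b := by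
      simp only [x₀, map_smul, smul_eq_mul]
      field_simp
    have hset : {x | ℓ x = b} = (fun x => x + -x₀) ⁻¹' (LinearMap.ker ℓ : Set _) := by
      ext x
      simp [hx₀, ← sub_eq_add_neg, sub_eq_zero]
    have hpre := measure_preimage_add_right (volume : Measure (EuclideanSpace ℝ (Fin d))) (-x₀)
      (LinearMap.ker ℓ : Set (EuclideanSpace ℝ (Fin d)))
    rw [hset, hpre]
    refine Measure.addHaar_submodule _ _ fun htop => hℓv ?_
    exact LinearMap.mem_ker.1 (htop ▸ Submodule.mem_top)
  have hP0 : P {x | ℓ x = b} = 0 := hac hnull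
  have hP1 : P {x | ℓ x = b}ᶜ = 0 := hae
  have := measure_union_le (μ := P) {x | ℓ x = b} {x | ℓ x = b}ᶜ
  rw [Set.union_compl_self, measure_univ, hP0, hP1] at this
  simp at this

theorem exists_tilted_of_posDef (m : EuclideanSpace ℝ (Fin d)) {S : Matrix (Fin d) (Fin d) ℝ}
    (hS : S.PosDef) : ∃ L : Matrix (Fin d) (Fin d) ℝ,
      multivariateGaussian m S = volume.tilted (fun x => -‖matVec L (x - m)‖ ^ 2 / 2) ∧
      Integrable fun x => Real.exp (-‖matVec L (x - m)‖ ^ 2 / 2) := by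
  obtain ⟨L, hL⟩ := exists_multivariateGaussian_eq_tilted m hS
  refine ⟨L, hL, ?_⟩
  by_contra hne
  rw [tilted_of_not_integrable hne] at hL
  exact IsProbabilityMeasure.ne_zero (multivariateGaussian m S) hL

/-- Among the measures of mass `c` with given mean and covariance, the Gaussian one has the least
relative entropy with respect to a nondegenerate Gaussian measure. -/
theorem klDiv_gaussian_le (hP : MemLp (fun x => x) 2 P) (m : EuclideanSpace ℝ (Fin d))
    {S : Matrix (Fin d) (Fin d) ℝ} (hS : S.PosDef) {c a : NNReal} (hc : c ≠ 0) (ha : a ≠ 0) :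
    klDiv (c • multivariateGaussian (∫ x, x ∂P) (covMatrix P (fun x => x) (fun x => x)))
        (a • multivariateGaussian m S)
      ≤ klDiv (c • P) (a • multivariateGaussian m S) := by
  refine klDiv_smul_le_smul hc ha fun hac hint => ?_
  obtain ⟨L, hL, hLi⟩ := exists_tilted_of_posDef m hS
  have hC : (covMatrix P (fun x => x) (fun x => x)).PosDef := by
    refine posDef_covMatrix_of_ac hP (hac.trans ?_)
    rw [hL]
    exact tilted_absolutelyContinuous _ _
  obtain ⟨M, hM, hMi⟩ := exists_tilted_of_posDef (∫ x, x ∂P) hC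
  have hG := memLp_id_multivariateGaussian (∫ x, x ∂P) (covMatrix P (fun x => x) (fun x => x))
  -- the log-densities are quadratic, so `P` and the Gaussian integrate them alike
  have hquad : ∀ (N : Matrix (Fin d) (Fin d) ℝ) (b : EuclideanSpace ℝ (Fin d)),
      ∫ x, -‖matVec N (x - b)‖ ^ 2 / 2
          ∂(multivariateGaussian (∫ x, x ∂P) (covMatrix P (fun x => x) (fun x => x)))
        = ∫ x, -‖matVec N (x - b)‖ ^ 2 / 2 ∂P := by
    intro N b
    rw [integral_neg_half_norm_sq hG, integral_neg_half_norm_sq hP,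
      covMatrix_multivariateGaussian _ hC.posSemidef, integral_id_multivariateGaussian]
  have hfG := integrable_neg_half_norm_sq hG L m
  have hgG := integrable_neg_half_norm_sq hG M (∫ x, x ∂P)
  have h1 := hquad L m
  have h2 := hquad M (∫ x, x ∂P)
  rw [hM] at hfG hgG h1 h2 ⊢
  rw [hL] at hac hint ⊢
  exact klDiv_tilted_le hLi hMi (integrable_neg_half_norm_sq hP L m)
    (integrable_neg_half_norm_sq hP M _) hfG hgG h1 h2 hac hint

end Moments

/-! ### Moments along the controlled trajectory -/

theorem memLp_two_of_lintegral_lt_top {Ω E : Type*} [MeasurableSpace Ω] [NormedAddCommGroup E]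
    {μ : Measure Ω} {f : Ω → E} (hf : AEStronglyMeasurable f μ) (h : ∫⁻ ω, ‖f ω‖ₑ ^ 2 ∂μ < ⊤) :
    MemLp f 2 μ := by
  refine ⟨hf, ?_⟩
  rw [eLpNorm_lt_top_iff_lintegral_rpow_enorm_lt_top two_ne_zero (by simp)]
  simpa using h

theorem lintegral_enorm_sq_eq {Ω : Type*} [MeasurableSpace Ω] {P : Measure Ω}
    [IsProbabilityMeasure P] {n : ℕ} {X : Ω → EuclideanSpace ℝ (Fin n)} (hX : MemLp X 2 P) :
    ∫⁻ ω, ‖X ω‖ₑ ^ 2 ∂P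
      = ENNReal.ofReal (‖∫ ω, X ω ∂P‖ ^ 2 + (covMatrix P X X).trace) := by
  rw [← integral_norm_sq_eq hX, ofReal_integral_eq_lintegral_ofReal
    (hX.integrable_norm_pow two_ne_zero) (Filter.Eventually.of_forall fun _ => sq_nonneg _)]
  refine lintegral_congr fun ω => ?_
  rw [ENNReal.ofReal_pow (norm_nonneg _), ofReal_norm]

/-- Replacing a joint law of `(x, u)` by the Gaussian `x` with the same mean and covariance and the
affine-Gaussian kernel with the regression gain and the residual covariance turns the law of
`A x + B u` into the Gaussian with the same mean and covariance. -/
theorem map_compProd_regression {d d' k : ℕ}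
    {P : Measure (EuclideanSpace ℝ (Fin d) × EuclideanSpace ℝ (Fin d'))} [IsProbabilityMeasure P]
    (h1 : MemLp Prod.fst 2 P) (h2 : MemLp Prod.snd 2 P)
    (A : Matrix (Fin k) (Fin d) ℝ) (B : Matrix (Fin k) (Fin d') ℝ) :
    (multivariateGaussian (∫ z, z.1 ∂P) (covMatrix P Prod.fst Prod.fst) ⊗ₘ
        affineGaussianKernel (∫ z, z.2 ∂P)
          (covMatrix P Prod.snd Prod.fst * pinv (covMatrix P Prod.fst Prod.fst)) (∫ z, z.1 ∂P)
          (covMatrix P Prod.snd Prod.snd - covMatrix P Prod.snd Prod.fst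
            * pinv (covMatrix P Prod.fst Prod.fst) * (covMatrix P Prod.snd Prod.fst).transpose)).map
        (fun z => matVec A z.1 + matVec B z.2)
      = multivariateGaussian (∫ z, (matVec A z.1 + matVec B z.2) ∂P)
          (covMatrix P (fun z => matVec A z.1 + matVec B z.2)
            (fun z => matVec A z.1 + matVec B z.2)) := by
  rw [map_compProd_affineGaussianKernel A B _ (posSemidef_covMatrix h1) _ _
    (posSemidef_covMatrix_sub h1 h2), ← covMatrix_matVec_add_matVec A B h1 h2,
    ← integral_matVec_add_matVec A B h1 h2]

section Trajectory

variable {d d' T : ℕ} {A : Matrix (Fin d) (Fin d) ℝ} {B : Matrix (Fin d) (Fin d') ℝ}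
  {π₀ : Measure (EuclideanSpace ℝ (Fin d))} {U : Policy d d'} {t : ℕ}

theorem Admissible.isFiniteMeasure (hU : Admissible T A B π₀ U) (ht : t < T) :
    IsFiniteMeasure (stateMeasure A B π₀ U t) := (hU.moment t ht).1

theorem measurable_dynamics (A : Matrix (Fin d) (Fin d) ℝ) (B : Matrix (Fin d) (Fin d') ℝ) :
    Measurable fun z : EuclideanSpace ℝ (Fin d) × EuclideanSpace ℝ (Fin d') =>
      matVec A z.1 + matVec B z.2 := by
  fun_prop

theorem Admissible.stateMeasure_univ (hU : Admissible T A B π₀ U) :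
    ∀ t < T, stateMeasure A B π₀ U t Set.univ = π₀ Set.univ
  | 0, _ => rfl
  | t + 1, ht => by
    have := hU.isFiniteMeasure (t := t) (by omega)
    have := hU.markov t (by omega)
    rw [stateMeasure, Measure.map_apply (measurable_dynamics A B) MeasurableSet.univ,
      Set.preimage_univ, Measure.compProd_apply_univ, hU.stateMeasure_univ t (by omega)]

theorem Admissible.mass_ne_top (hT : 1 ≤ T) (hU : Admissible T A B π₀ U) :
    π₀ Set.univ ≠ ⊤ :=
  have := hU.isFiniteMeasure (t := 0) hT
  measure_ne_top (stateMeasure A B π₀ U 0) _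

theorem Admissible.isProbabilityMeasure_stateLaw (hU : Admissible T A B π₀ U)
    (hmass : 0 < π₀ Set.univ) (ht : t < T) : IsProbabilityMeasure (stateLaw A B π₀ U t) := by
  constructor
  rw [stateLaw, Measure.smul_apply, hU.stateMeasure_univ t ht, smul_eq_mul,
    ENNReal.inv_mul_cancel hmass.ne' (hU.mass_ne_top (by omega))]

theorem Admissible.jointLaw_eq (hU : Admissible T A B π₀ U) (ht : t < T - 1) :
    jointLaw A B π₀ U t = stateLaw A B π₀ U t ⊗ₘ U t := by
  have := hU.isFiniteMeasure (t := t) (by omega)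
  have := hU.markov t ht
  rw [jointLaw, stateLaw, Measure.compProd_smul_left]

theorem Admissible.isProbabilityMeasure_jointLaw (hU : Admissible T A B π₀ U)
    (hmass : 0 < π₀ Set.univ) (ht : t < T - 1) : IsProbabilityMeasure (jointLaw A B π₀ U t) := by
  have := hU.isProbabilityMeasure_stateLaw (t := t) hmass (by omega)
  have := hU.markov t ht
  rw [hU.jointLaw_eq ht]
  infer_instance

theorem Admissible.map_fst_jointLaw (hU : Admissible T A B π₀ U)
    (hmass : 0 < π₀ Set.univ) (ht : t < T - 1) :
    (jointLaw A B π₀ U t).map Prod.fst = stateLaw A B π₀ U t := by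
  have := hU.isProbabilityMeasure_stateLaw (t := t) hmass (by omega)
  have := hU.markov t ht
  rw [hU.jointLaw_eq ht]
  exact Measure.fst_compProd _ _

theorem stateLaw_succ : stateLaw A B π₀ U (t + 1)
    = (jointLaw A B π₀ U t).map (fun z => matVec A z.1 + matVec B z.2) := by
  rw [stateLaw, jointLaw, stateMeasure, Measure.map_smul]

theorem smul_stateLaw (hmass : 0 < π₀ Set.univ) (hfin : π₀ Set.univ ≠ ⊤) :
    π₀ Set.univ • stateLaw A B π₀ U t = stateMeasure A B π₀ U t := by
  rw [stateLaw, smul_smul, ENNReal.mul_inv_cancel hmass.ne' hfin, one_smul]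

theorem Admissible.memLp_stateLaw (hU : Admissible T A B π₀ U) (hmass : 0 < π₀ Set.univ)
    (ht : t < T) : MemLp (fun x => x) 2 (stateLaw A B π₀ U t) := by
  refine memLp_two_of_lintegral_lt_top aestronglyMeasurable_id ?_
  rw [stateLaw, lintegral_smul_measure]
  exact ENNReal.mul_lt_top (ENNReal.inv_lt_top.2 hmass) (hU.moment t ht).2

theorem Admissible.memLp_fst (hU : Admissible T A B π₀ U) (hmass : 0 < π₀ Set.univ)
    (ht : t < T - 1) : MemLp Prod.fst 2 (jointLaw A B π₀ U t) := by
  have h := hU.memLp_stateLaw (t := t) hmass (by omega)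
  rw [← hU.map_fst_jointLaw hmass ht] at h
  exact h.comp_of_map measurable_fst.aemeasurable

/-- The control effort at one time, as a second moment of the joint law. -/
theorem Admissible.lintegral_control_eq (hU : Admissible T A B π₀ U) (hmass : 0 < π₀ Set.univ)
    (ht : t < T - 1) :
    ∫⁻ x, ∫⁻ u, ‖u‖ₑ ^ 2 ∂(U t x) ∂(stateMeasure A B π₀ U t)
      = π₀ Set.univ * ∫⁻ z, ‖z.2‖ₑ ^ 2 ∂(jointLaw A B π₀ U t) := by
  have hfin := hU.mass_ne_top (by omega)
  have := hU.isProbabilityMeasure_stateLaw (t := t) hmass (by omega)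
  have := hU.markov t ht
  rw [hU.jointLaw_eq ht, Measure.lintegral_compProd (by fun_prop), ← smul_eq_mul,
    ← lintegral_smul_measure, smul_stateLaw hmass hfin]

theorem Admissible.memLp_snd (hU : Admissible T A B π₀ U) (hmass : 0 < π₀ Set.univ)
    (ht : t < T - 1) : MemLp Prod.snd 2 (jointLaw A B π₀ U t) := by
  refine memLp_two_of_lintegral_lt_top measurable_snd.aestronglyMeasurable ?_
  have h := (ENNReal.sum_lt_top.1 hU.control) t (Finset.mem_range.2 ht)
  rw [hU.lintegral_control_eq hmass ht] at h
  by_contra hne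
  rw [not_lt, top_le_iff] at hne
  rw [hne, ENNReal.mul_top hmass.ne'] at h
  exact h.ne rfl

theorem Admissible.stateMean_eq (hU : Admissible T A B π₀ U) (hmass : 0 < π₀ Set.univ)
    (ht : t < T - 1) : stateMean A B π₀ U t = ∫ z, z.1 ∂(jointLaw A B π₀ U t) := by
  rw [stateMean, ← hU.map_fst_jointLaw hmass ht,
    integral_map measurable_fst.aemeasurable measurable_id'.aestronglyMeasurable]

theorem Admissible.stateCov_eq (hU : Admissible T A B π₀ U) (hmass : 0 < π₀ Set.univ)
    (ht : t < T - 1) :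
    stateCov A B π₀ U t = covMatrix (jointLaw A B π₀ U t) Prod.fst Prod.fst := by
  change covMatrix (stateLaw A B π₀ U t) (fun x => x) (fun x => x) = _
  rw [← hU.map_fst_jointLaw hmass ht, covMatrix_map measurable_fst measurable_id' measurable_id']

theorem Admissible.residualCov_eq (hU : Admissible T A B π₀ U) (hmass : 0 < π₀ Set.univ)
    (ht : t < T - 1) :
    residualCov A B π₀ U t = covMatrix (jointLaw A B π₀ U t) Prod.snd Prod.snd
      - covMatrix (jointLaw A B π₀ U t) Prod.snd Prod.fst
        * pinv (covMatrix (jointLaw A B π₀ U t) Prod.fst Prod.fst)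
        * (covMatrix (jointLaw A B π₀ U t) Prod.snd Prod.fst).transpose := by
  rw [residualCov, hU.stateCov_eq hmass ht]
  rfl

theorem stateMean_succ : stateMean A B π₀ U (t + 1)
    = ∫ z, (matVec A z.1 + matVec B z.2) ∂(jointLaw A B π₀ U t) := by
  rw [stateMean, stateLaw_succ,
    integral_map (measurable_dynamics A B).aemeasurable measurable_id'.aestronglyMeasurable]

theorem stateCov_succ : stateCov A B π₀ U (t + 1)
    = covMatrix (jointLaw A B π₀ U t) (fun z => matVec A z.1 + matVec B z.2)
        (fun z => matVec A z.1 + matVec B z.2) := by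
  change covMatrix (stateLaw A B π₀ U (t + 1)) (fun x => x) (fun x => x) = _
  rw [stateLaw_succ, covMatrix_map (measurable_dynamics A B) measurable_id' measurable_id']

/-! ### The Gaussian trajectory -/

/-- The matched Gaussian joint law has Gaussian affine images with the moments of the original
joint law. -/
theorem Admissible.map_gaussianPolicy (hU : Admissible T A B π₀ U) (hmass : 0 < π₀ Set.univ)
    (ht : t < T - 1) {k : ℕ} (C : Matrix (Fin k) (Fin d) ℝ) (D : Matrix (Fin k) (Fin d') ℝ) :
    (multivariateGaussian (stateMean A B π₀ U t) (stateCov A B π₀ U t) ⊗ₘ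
        gaussianPolicy A B π₀ U t).map (fun z => matVec C z.1 + matVec D z.2)
      = multivariateGaussian (∫ z, (matVec C z.1 + matVec D z.2) ∂(jointLaw A B π₀ U t))
          (covMatrix (jointLaw A B π₀ U t) (fun z => matVec C z.1 + matVec D z.2)
            (fun z => matVec C z.1 + matVec D z.2)) := by
  have := hU.isProbabilityMeasure_jointLaw hmass ht
  rw [← map_compProd_regression (hU.memLp_fst hmass ht) (hU.memLp_snd hmass ht) C D,
    gaussianPolicy, hU.residualCov_eq hmass ht, hU.stateMean_eq hmass ht, hU.stateCov_eq hmass ht]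
  rfl

instance isMarkovKernel_gaussianPolicy : IsMarkovKernel (gaussianPolicy A B π₀ U t) :=
  isMarkovKernel_affineGaussianKernel _ _ _ _

/-- The Gaussian pair reproduces, at every time, the mass, mean and covariance of the state. -/
theorem Admissible.stateMeasure_gaussian (hU : Admissible T A B π₀ U)
    (hmass : 0 < π₀ Set.univ) : ∀ t < T,
    stateMeasure A B (gaussianInit A B π₀ U) (gaussianPolicy A B π₀ U) t
      = π₀ Set.univ • multivariateGaussian (stateMean A B π₀ U t) (stateCov A B π₀ U t)
  | 0, ht => by
    rw [stateMeasure, gaussianInit, gaussianMeasure, Measure.real,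
      ENNReal.ofReal_toReal (hU.mass_ne_top ht)]
  | t + 1, ht => by
    rw [stateMeasure, hU.stateMeasure_gaussian hmass t (by omega), Measure.compProd_smul_left,
      Measure.map_smul, hU.map_gaussianPolicy hmass (by omega), stateMean_succ, stateCov_succ]

theorem Admissible.lintegral_control_gaussian (hU : Admissible T A B π₀ U)
    (hmass : 0 < π₀ Set.univ) (ht : t < T - 1) :
    ∫⁻ x, ∫⁻ u, ‖u‖ₑ ^ 2 ∂(gaussianPolicy A B π₀ U t x)
        ∂(stateMeasure A B (gaussianInit A B π₀ U) (gaussianPolicy A B π₀ U) t)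
      = ∫⁻ x, ∫⁻ u, ‖u‖ₑ ^ 2 ∂(U t x) ∂(stateMeasure A B π₀ U t) := by
  have := hU.isProbabilityMeasure_jointLaw hmass ht
  have h2 := hU.memLp_snd hmass ht
  rw [hU.lintegral_control_eq hmass ht, hU.stateMeasure_gaussian hmass t (by omega),
    lintegral_smul_measure, smul_eq_mul,
    ← Measure.lintegral_compProd (f := fun z : EuclideanSpace ℝ (Fin d) ×
      EuclideanSpace ℝ (Fin d') => ‖z.2‖ₑ ^ 2) (by fun_prop)]
  congr 1
  -- `u = 0 x + 1 u` is Gaussian under the matched joint law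
  have hmap := hU.map_gaussianPolicy hmass ht (0 : Matrix (Fin d') (Fin d) ℝ) 1
  have hsnd : (fun z : EuclideanSpace ℝ (Fin d) × EuclideanSpace ℝ (Fin d') =>
      matVec (0 : Matrix (Fin d') (Fin d) ℝ) z.1 + matVec 1 z.2) = Prod.snd := by
    ext z; simp [matVec]
  simp only [hsnd] at hmap
  rw [← lintegral_map (f := fun u : EuclideanSpace ℝ (Fin d') => ‖u‖ₑ ^ 2) (by fun_prop)
    measurable_snd, hmap, lintegral_enorm_sq_eq (memLp_id_multivariateGaussian _ _),
    lintegral_enorm_sq_eq h2, integral_id_multivariateGaussian,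
    covMatrix_multivariateGaussian _ (posSemidef_covMatrix h2)]

theorem Admissible.controlCost_gaussian (hU : Admissible T A B π₀ U) (hmass : 0 < π₀ Set.univ) :
    controlCost T A B (gaussianInit A B π₀ U) (gaussianPolicy A B π₀ U)
      = controlCost T A B π₀ U :=
  Finset.sum_congr rfl fun _ ht => hU.lintegral_control_gaussian hmass (Finset.mem_range.1 ht)

theorem Admissible.gaussian (hU : Admissible T A B π₀ U) (hmass : 0 < π₀ Set.univ) :
    Admissible T A B (gaussianInit A B π₀ U) (gaussianPolicy A B π₀ U) where
  markov t _ := inferInstance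
  moment t ht := by
    have hfin := hU.mass_ne_top (by omega)
    rw [hU.stateMeasure_gaussian hmass t ht]
    refine ⟨Measure.smul_finite _ hfin, ?_⟩
    rw [lintegral_smul_measure, lintegral_enorm_sq_eq (memLp_id_multivariateGaussian _ _)]
    exact ENNReal.mul_lt_top hfin.lt_top ENNReal.ofReal_lt_top
  control := by
    rw [hU.controlCost_gaussian hmass]
    exact hU.control

theorem Admissible.klDiv_stateMeasure_le (hU : Admissible T A B π₀ U) (hmass : 0 < π₀ Set.univ)
    (ht : t < T) {a : ℝ} (ha : 0 < a) (m : EuclideanSpace ℝ (Fin d))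
    {S : Matrix (Fin d) (Fin d) ℝ} (hS : S.PosDef) :
    klDiv (stateMeasure A B (gaussianInit A B π₀ U) (gaussianPolicy A B π₀ U) t)
        (gaussianMeasure a m S)
      ≤ klDiv (stateMeasure A B π₀ U t) (gaussianMeasure a m S) := by
  have hfin := hU.mass_ne_top (by omega)
  have := hU.isProbabilityMeasure_stateLaw hmass ht
  have hc : (π₀ Set.univ).toNNReal ≠ 0 := (ENNReal.toNNReal_pos hmass.ne' hfin).ne'
  have ha' : a.toNNReal ≠ 0 := (Real.toNNReal_pos.2 ha).ne'
  have h := klDiv_gaussian_le (hU.memLp_stateLaw hmass ht) m hS hc ha'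
  rw [← Measure.coe_nnreal_smul, ← Measure.coe_nnreal_smul, ← Measure.coe_nnreal_smul,
    ENNReal.coe_toNNReal hfin, smul_stateLaw hmass hfin] at h
  rw [hU.stateMeasure_gaussian hmass t ht]
  exact h

end Trajectory

end UDC

end

theorem mainTheorem2 {d d' : ℕ} (T : ℕ) (hT : 1 ≤ T)
    (A : Matrix (Fin d) (Fin d) ℝ) (hA : IsUnit A.det) (B : Matrix (Fin d) (Fin d') ℝ)
    (cα cβ : ℝ) (hcα : 0 < cα) (hcβ : 0 < cβ)
    (mα mβ : EuclideanSpace ℝ (Fin d)) (Sα Sβ : Matrix (Fin d) (Fin d) ℝ)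
    (hSα : Sα.PosDef) (hSβ : Sβ.PosDef) (γ : ℝ) (hγ : 0 < γ)
    (π₀ : Measure (EuclideanSpace ℝ (Fin d))) (U : UDC.Policy d d')
    (hU : UDC.Admissible T A B π₀ U) (hmass : 0 < π₀ Set.univ) :
    (UDC.stateCov A B π₀ U 0).PosSemidef ∧
    (∀ t < T - 1, (UDC.residualCov A B π₀ U t).PosSemidef) ∧
    UDC.Admissible T A B (UDC.gaussianInit A B π₀ U) (UDC.gaussianPolicy A B π₀ U) ∧
    UDC.cost T A B γ (UDC.gaussianMeasure cα mα Sα) (UDC.gaussianMeasure cβ mβ Sβ)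
        (UDC.gaussianInit A B π₀ U) (UDC.gaussianPolicy A B π₀ U) ≤
      UDC.cost T A B γ (UDC.gaussianMeasure cα mα Sα) (UDC.gaussianMeasure cβ mβ Sβ) π₀ U := by
  refine ⟨?_, fun t ht => ?_, hU.gaussian hmass, ?_⟩
  · have := hU.isProbabilityMeasure_stateLaw (t := 0) hmass hT
    exact UDC.posSemidef_covMatrix (hU.memLp_stateLaw hmass hT)
  · have := hU.isProbabilityMeasure_jointLaw hmass ht
    rw [hU.residualCov_eq hmass ht]
    exact UDC.posSemidef_covMatrix_sub (hU.memLp_fst hmass ht) (hU.memLp_snd hmass ht)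
  · unfold UDC.cost
    rw [hU.controlCost_gaussian hmass]
    gcongr
    · exact hU.klDiv_stateMeasure_le (t := 0) hmass hT hcα mα hSα
    · exact hU.klDiv_stateMeasure_le hmass (by omega) hcβ mβ hSβ
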